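/- **Setting.** Let $\mathcal A=\bigoplus_{k\in\mathbb Z^n}\mathcal A^{(k)}$ be a unital complex $*$-algebra graded by $\mathbb Z^n$ with $(\mathcal A^{(k)})^*\subseteq\mathcal A^{(-k)}$ (equivalently, a comodule $*$-algebra over the Hopf algebra of $\mathbb T^n$; in particular it may be the total algebra of a quantum principal $\mathbb T^n$-bundle). Let $\delta_j$ be the derivation of $\mathcal A$ with $\delta_j(a)=k_ja$ for $a\in\mathcal A^{(k)}$, and let $\mathcal B=\mathcal A^{(0)}$ be the invariant subalgebra. A *spectral triple* $(\mathcal A,\mathcal H,D)$ is a unital $*$-representation of $\mathcal A$ by bounded operators on a Hilbert space $\mathcal H$ together with a (densely defined) selfadjoint operator $D$ with compact resolvent such that every $a\in\mathcal A$ preserves $\mathrm{dom}\,D$ and $[D,a]$ is bounded. It is an *even real spectral triple* $(\mathcal A,\mathcal H,D,J,\gamma)$ of (even) $KR$-dimension $d$ modulo $8$ if $\gamma$ is bounded with $\gamma^2=1$, $\gamma^*=\gamma$, $[\gamma,a]=0$ for $a\in\mathcal A$, $\gamma D=-D\gamma$, and $J$ is antiunitary with $J^2=\epsilon$, $JD=DJ$,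 $J\gamma=\epsilon''\gamma J$, where $(\epsilon,\epsilon'')=(+,+),(-,-),(-,+),(+,-)$ for $d=0,2,4,6$, and $[a,Jb^*J^{-1}]=0$, $[[D,a],Jb^*J^{-1}]=0$ for all $a,b\in\mathcal A$. It is *$\mathbb T^n$-equivariant* if it comes with selfadjoint operators $\delta_1,\dots,\delta_n$ on $\mathcal H$ which commute strongly with one another and with $D$, satisfy $\delta_jJ=-J\delta_j$ and $[\delta_j,\gamma]=0$, and have a common core stable under $\mathcal A$ on which $\delta_j(a\psi)=\delta_j(a)\psi+a\,\delta_j\psi$. It is *projectable* if there is a bounded operator $\Gamma$ on $\mathcal H$ with $\Gamma^2=1$, $\Gamma^*=\Gamma$, $[\Gamma,a]=0$ for $a\in\mathcal A$, $[\Gamma,\delta_j]=0$, $J\Gamma=-\Gamma J$, $\Gamma\gamma=(-1)^n\gamma\Gamma$. The *horizontal Dirac operator* is, on $\{\psi\in\mathrm{dom}\,D:\Gamma\psi\in\mathrm{dom}\,D\}$, $$D_h=\tfrac12\Gamma(D\Gamma+\Gamma D)\ \ (n\text{ even}),\qquad D_h=s\,\tfrac12\Gamma(D\Gamma-\Gamma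 D)\ \ (n\text{ odd}),$$ where $s\in\{1,-1\}$ is a fixed sign convention (for $s=-1$, $D_h=\tfrac12(D-\Gamma D\Gamma)$ is the part of $D$ anticommuting with $\Gamma$). Let $\mathcal H_0=\bigcap_j\ker\delta_j$. The fibres are *isometric* if there are an operator $D_v$ and a bounded operator $Z$ on $\mathcal H$ with $D=D_v+D_h+Z$ (as unbounded operators, including domains) such that: $D_v$ vanishes on $\mathcal H_0\cap\mathrm{dom}\,D_v$; $D_v$ commutes with $\Gamma$ if $n$ is odd and anticommutes with $\Gamma$ if $n$ is even; $D_v$ commutes with (the resolvents of) every $\delta_j$; $Z$ commutes with $\mathcal A$; and there is a bounded selfadjoint $Z'$ with $Ja^*J^{-1}Z=Z'Ja^*J^{-1}$ for all $a\in\mathcal A$. **Proposition.** Let $(\mathcal A,\mathcal H,D,J,\gamma,\{\delta_j\},\Gamma)$ be an even projectable $\mathbb T^n$-equivariant real spectral triple with isometric fibres. Then $\mathcal H_0$ is a closed subspace, $\mathcal B$, $J$, $\gamma$, $\Gamma$ and $\gamma\Gamma$ restrict to $\mathcal H_0$, and $D_h$ maps $\mathcal H_0\cap\mathrm{dom}\,D_h$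 into $\mathcal H_0$. Let $J_0$ be the (antiunitary) restriction of $J$, and $D_0$ the restriction of $D_h$ with domain $\mathcal H_0\cap\mathrm{dom}\,D_h$. Then: 1. $(\mathcal B,\mathcal H_0,D_0)$ is a spectral triple. 2. $hb=b^\circ h=J_0b^*J_0^{-1}h$ ($b\in\mathcal B$, $h\in\mathcal H_0$) defines a right action of $\mathcal B$ on $\mathcal H_0$, that is, a unital $*$-representation of the opposite algebra $\mathcal B^\circ$. 3. $[b,J_0c^*J_0^{-1}]=0$ for all $b,c\in\mathcal B$; that is, $J_0$ maps $\mathcal B$ into its commutant. 4. $[[D_0,b],J_0c^*J_0^{-1}]=0$ for all $b,c\in\mathcal B$ (first order condition). 5. $\gamma$ anticommutes with $D_0$: $\gamma$ preserves $\mathrm{dom}\,D_0$ and $\gamma D_0=-D_0\gamma$. -/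

import Mathlib

/-! ### Unbounded operators on a Hilbert space -/

namespace TorusTriple

section Unbounded

variable {H : Type*} [NormedAddCommGroup H] [InnerProductSpace ℂ H]

/-- `S T ⊆ c T S` for an unbounded operator `T`, an everywhere defined map `S` and a sign
`c = 1` or `c = -1`: `S` maps the domain of `T` into itself, and `T (S ψ) = c S (T ψ)` there.
For `c = 1` this is `[S, T] = 0`, for `c = -1` it is `S T + T S = 0`. -/
def CommutesUpTo (T : H →ₗ.[ℂ] H) (S : H → H) (c : ℤ) : Prop :=
  ∀ ψ (hψ : ψ ∈ T.domain), ∃ h : S ψ ∈ T.domain, T ⟨S ψ, h⟩ = c • S (T ⟨ψ, hψ⟩)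

/-- Strong commutation `[δ, T] = 0` of an unbounded selfadjoint operator `δ` with an unbounded
operator `T`: every non-real resolvent of `δ` commutes with `T`, that is
`(δ - z)⁻¹ T ⊆ T (δ - z)⁻¹`. -/
def StronglyCommutes (δ T : H →ₗ.[ℂ] H) : Prop :=
  ∀ z : ℂ, z.im ≠ 0 → ∀ φ (hφ : φ ∈ δ.domain) (hT : δ ⟨φ, hφ⟩ - z • φ ∈ T.domain),
    ∃ (hφT : φ ∈ T.domain) (hTφ : T ⟨φ, hφT⟩ ∈ δ.domain),
      δ ⟨T ⟨φ, hφT⟩, hTφ⟩ - z • T ⟨φ, hφT⟩ = T ⟨δ ⟨φ, hφ⟩ - z • φ, hT⟩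

/-- The bounded operator `C` is the commutator `[T, S]`: the bounded operator `S` preserves the
domain of `T`, and `T S - S T = C` on that domain. (For densely defined `T` there is at most one
such `C`.) -/
def IsCommutator (T : H →ₗ.[ℂ] H) (S C : H →L[ℂ] H) : Prop :=
  ∀ ψ (hψ : ψ ∈ T.domain), ∃ h : S ψ ∈ T.domain, T ⟨S ψ, h⟩ - S (T ⟨ψ, hψ⟩) = C ψ

/-- `(T - i)⁻¹` exists as an everywhere defined compact operator. -/
def HasCompactResolvent (T : H →ₗ.[ℂ] H) : Prop :=
  ∃ R : H →L[ℂ] H, IsCompactOperator R ∧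
    (∀ ψ, ∃ h : R ψ ∈ T.domain, T ⟨R ψ, h⟩ - Complex.I • R ψ = ψ) ∧
    (∀ ψ (hψ : ψ ∈ T.domain), R (T ⟨ψ, hψ⟩ - Complex.I • ψ) = ψ)

/-- A bounded operator as an unbounded operator with domain the whole space. -/
def ofBounded (S : H →L[ℂ] H) : H →ₗ.[ℂ] H :=
  (S : H →ₗ[ℂ] H).toPMap ⊤

/-- The composition `S T` on the domain of `T`. -/
def leftMul (S : H →L[ℂ] H) (T : H →ₗ.[ℂ] H) : H →ₗ.[ℂ] H :=
  (S : H →ₗ[ℂ] H).compPMap T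

/-- The composition `T S` on `{ψ | S ψ ∈ dom T}`. -/
def rightMul (T : H →ₗ.[ℂ] H) (S : H →L[ℂ] H) : H →ₗ.[ℂ] H where
  domain := T.domain.comap (S : H →ₗ[ℂ] H)
  toFun := T.toFun ∘ₗ ((S : H →ₗ[ℂ] H).restrict fun _ hx => hx)

/-- The common kernel `{ψ | δ₁ ψ = ⋯ = δₙ ψ = 0}`. -/
def commonKernel {n : ℕ} (δ : Fin n → H →ₗ.[ℂ] H) : Submodule ℂ H :=
  ⨅ j, (LinearMap.ker (δ j).toFun).map (δ j).domain.subtype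

theorem mem_commonKernel {n : ℕ} (δ : Fin n → H →ₗ.[ℂ] H) (ψ : H) :
    ψ ∈ commonKernel δ ↔ ∀ j, ∃ h : ψ ∈ (δ j).domain, δ j ⟨ψ, h⟩ = 0 := by
  simp [commonKernel, LinearPMap.toFun_eq_coe]

/-- `T₀` is the restriction of the unbounded operator `T` to the subspace `K`: its domain is
`K ∩ dom T`, on which `T` takes values in `K`. -/
def IsRestriction (T : H →ₗ.[ℂ] H) {K : Submodule ℂ H} (T₀ : K →ₗ.[ℂ] K) : Prop :=
  (∀ ψ : K, ψ ∈ T₀.domain ↔ (ψ : H) ∈ T.domain) ∧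
    ∀ (ψ : K) (h₀ : ψ ∈ T₀.domain) (h : (ψ : H) ∈ T.domain), (T₀ ⟨ψ, h₀⟩ : H) = T ⟨ψ, h⟩

end Unbounded

/-! ### The algebra: an action of the `n`-torus as a grading by `ℤⁿ` -/

section Algebra

variable {n : ℕ} {A : Type*} [Ring A] [StarRing A] [Algebra ℂ A] [StarModule ℂ A]

/-- The grading is compatible with the involution: `(A^(k))* ⊆ A^(-k)`. -/
class StarGraded (𝒜 : (Fin n → ℤ) → Submodule ℂ A) : Prop where
  star_mem : ∀ k a, a ∈ 𝒜 k → star a ∈ 𝒜 (-k)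

/-- The derivation `δ_j` of `A`, with `δ_j a = k_j a` for `a ∈ A^(k)`. -/
noncomputable def gradingDerivation (𝒜 : (Fin n → ℤ) → Submodule ℂ A) [GradedAlgebra 𝒜]
    (j : Fin n) : A →ₗ[ℂ] A :=
  (DirectSum.toModule ℂ (Fin n → ℤ) A fun k => ((k j : ℤ) : ℂ) • (𝒜 k).subtype) ∘ₗ
    (DirectSum.decomposeLinearEquiv 𝒜).toLinearMap

theorem gradingDerivation_apply (𝒜 : (Fin n → ℤ) → Submodule ℂ A) [GradedAlgebra 𝒜]
    (j : Fin n) (k : Fin n → ℤ) (a : A) (ha : a ∈ 𝒜 k) :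
    gradingDerivation 𝒜 j a = ((k j : ℤ) : ℂ) • a := by
  have h := DirectSum.decompose_of_mem 𝒜 ha
  simp only [gradingDerivation, LinearMap.comp_apply, LinearEquiv.coe_coe,
    DirectSum.decomposeLinearEquiv_apply, h]
  erw [DirectSum.toModule_lof]
  simp

/-- The invariant subalgebra `B = A^(0)`. -/
def invariants (𝒜 : (Fin n → ℤ) → Submodule ℂ A) [GradedAlgebra 𝒜] [StarGraded 𝒜] :
    StarSubalgebra ℂ A where
  carrier := 𝒜 0
  mul_mem' ha hb := by simpa using SetLike.GradedMul.mul_mem ha hb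
  one_mem' := SetLike.GradedOne.one_mem
  add_mem' := (𝒜 0).add_mem
  zero_mem' := (𝒜 0).zero_mem
  algebraMap_mem' := SetLike.algebraMap_mem_graded 𝒜
  star_mem' ha := by simpa using StarGraded.star_mem (𝒜 := 𝒜) 0 _ ha

end Algebra

/-! ### Spectral triples -/

section Triples

variable {A : Type*} [Ring A] [StarRing A] [Algebra ℂ A] [StarModule ℂ A]
variable {H : Type*} [NormedAddCommGroup H] [InnerProductSpace ℂ H] [CompleteSpace H]

/-- The operator `J a* J⁻¹`, by which `a` acts from the right: `ψ ⬝ a = J a* J⁻¹ ψ`. -/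
noncomputable def rightAction (π : A →⋆ₐ[ℂ] (H →L[ℂ] H)) (J : H ≃ₗᵢ⋆[ℂ] H) (a : A) :
    H →L[ℂ] H :=
  (J.toContinuousLinearEquiv : H →SL[starRingEnd ℂ] H).comp
    ((π (star a)).comp (J.symm.toContinuousLinearEquiv : H →SL[starRingEnd ℂ] H))

theorem rightAction_apply (π : A →⋆ₐ[ℂ] (H →L[ℂ] H)) (J : H ≃ₗᵢ⋆[ℂ] H) (a : A) (ψ : H) :
    rightAction π J a ψ = J (π (star a) (J.symm ψ)) := rfl

/-- `(A, H, D)` is a spectral triple. (Selfadjointness of an unbounded operator includes that it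
is densely defined.) -/
structure IsSpectralTriple (π : A →⋆ₐ[ℂ] (H →L[ℂ] H)) (D : H →ₗ.[ℂ] H) : Prop where
  selfAdjoint : IsSelfAdjoint D
  bounded_commutators : ∀ a, ∃ C : H →L[ℂ] H, IsCommutator D (π a) C
  compact_resolvent : HasCompactResolvent D

/-- `J` maps the algebra into its commutant: `[a, J b* J⁻¹] = 0` for all `a`, `b`. -/
def CommutantCondition (π : A →⋆ₐ[ℂ] (H →L[ℂ] H)) (J : H ≃ₗᵢ⋆[ℂ] H) : Prop :=
  ∀ a b, Commute (π a) (rightAction π J b)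

/-- The first order condition `[[D, a], J b* J⁻¹] = 0` for all `a`, `b`. -/
def FirstOrderCondition (π : A →⋆ₐ[ℂ] (H →L[ℂ] H)) (D : H →ₗ.[ℂ] H) (J : H ≃ₗᵢ⋆[ℂ] H) : Prop :=
  ∀ a b (C : H →L[ℂ] H), IsCommutator D (π a) C → Commute C (rightAction π J b)

/-- The sign `ε` in `J² = ε` for even `KR`-dimension `d`: `+, -, -, +` for
`d = 0, 2, 4, 6` modulo `8`. -/
def signJ (d : ℕ) : ℤ := if d % 8 = 0 ∨ d % 8 = 6 then 1 else -1

/-- The sign `ε''` in `J γ = ε'' γ J` for even `KR`-dimension `d`: `+, -, +, -` for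
`d = 0, 2, 4, 6` modulo `8`. -/
def signGrading (d : ℕ) : ℤ := if d % 4 = 0 then 1 else -1

/-- `(A, H, D, J, γ)` is an even real spectral triple of `KR`-dimension `d` (modulo `8`), with the
antiunitary `J`; the sign `ε'` in `J D = ε' D J` is `+` in all even dimensions. -/
structure IsEvenRealSpectralTriple (d : ℕ) (π : A →⋆ₐ[ℂ] (H →L[ℂ] H)) (D : H →ₗ.[ℂ] H)
    (J : H ≃ₗᵢ⋆[ℂ] H) (γ : H →L[ℂ] H) : Prop extends IsSpectralTriple π D where
  even_dim : Even d
  grading_sq : γ * γ = 1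
  grading_selfAdjoint : IsSelfAdjoint γ
  grading_algebra : ∀ a, Commute γ (π a)
  grading_D : CommutesUpTo D γ (-1)
  J_sq : ∀ ψ, J (J ψ) = signJ d • ψ
  J_D : CommutesUpTo D J 1
  J_grading : ∀ ψ, J (γ ψ) = signGrading d • γ (J ψ)
  commutant : CommutantCondition π J
  first_order : FirstOrderCondition π D J

variable {n : ℕ}

/-- The equivariance of `(A, H, D, J, γ)` under the `n`-torus, implemented by the commuting
selfadjoint operators `δ_1, …, δ_n` on `H`. The operators `δ_j` have a common domain of (essential)
selfadjointness which is stable under `A`, and on which they extend the derivations of `A`. -/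
structure IsTorusEquivariant (𝒜 : (Fin n → ℤ) → Submodule ℂ A) [GradedAlgebra 𝒜]
    (π : A →⋆ₐ[ℂ] (H →L[ℂ] H)) (D : H →ₗ.[ℂ] H) (J : H ≃ₗᵢ⋆[ℂ] H) (γ : H →L[ℂ] H)
    (δ : Fin n → H →ₗ.[ℂ] H) : Prop where
  selfAdjoint : ∀ j, IsSelfAdjoint (δ j)
  commuting : ∀ i j, StronglyCommutes (δ i) (δ j)
  leibniz : ∃ 𝒟 : Submodule ℂ H, (∀ j, (δ j).HasCore 𝒟) ∧
    (∀ a, ∀ ψ ∈ 𝒟, π a ψ ∈ 𝒟) ∧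
    ∀ j a ψ, ψ ∈ 𝒟 → ∀ (h : ψ ∈ (δ j).domain) (h' : π a ψ ∈ (δ j).domain),
      δ j ⟨π a ψ, h'⟩ = π (gradingDerivation 𝒜 j a) ψ + π a (δ j ⟨ψ, h⟩)
  delta_J : ∀ j, CommutesUpTo (δ j) J (-1)
  delta_grading : ∀ j, CommutesUpTo (δ j) γ 1
  delta_D : ∀ j, StronglyCommutes (δ j) D

/-- Projectability along the fibres of an even torus-equivariant real spectral triple, by
means of the grading `Γ`. -/
structure IsProjectable (π : A →⋆ₐ[ℂ] (H →L[ℂ] H)) (J : H ≃ₗᵢ⋆[ℂ] H) (γ : H →L[ℂ] H)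
    (δ : Fin n → H →ₗ.[ℂ] H) (Γ : H →L[ℂ] H) : Prop where
  sq : Γ * Γ = 1
  selfAdjoint : IsSelfAdjoint Γ
  algebra : ∀ a, Commute Γ (π a)
  delta : ∀ j, CommutesUpTo (δ j) Γ 1
  real : ∀ ψ, J (Γ ψ) = -Γ (J ψ)
  grading : Γ * γ = (-1 : ℂ) ^ n • (γ * Γ)

/-- The horizontal Dirac operator: `½ Γ (D Γ + Γ D)` for even `n`, and `s ½ Γ (D Γ - Γ D)` for odd
`n`, with a sign `s`, on `{ψ ∈ dom D | Γ ψ ∈ dom D}`. For `s = -1` the latter is the part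
`½ (D - Γ D Γ)` of `D` that anticommutes with `Γ`, for `s = 1` it is the negative of this part. -/
noncomputable def horizontal (n : ℕ) (s : ℤˣ) (D : H →ₗ.[ℂ] H) (Γ : H →L[ℂ] H) : H →ₗ.[ℂ] H :=
  if Even n then (1 / 2 : ℂ) • leftMul Γ (rightMul D Γ + leftMul Γ D)
  else (((s : ℤ) : ℂ) * (1 / 2)) • leftMul Γ (rightMul D Γ - leftMul Γ D)

/-- Isometric fibres: `D = D_v + D_h + Z`, an equality of unbounded operators (with domains). -/
def HasIsometricFibres (π : A →⋆ₐ[ℂ] (H →L[ℂ] H)) (D : H →ₗ.[ℂ] H) (J : H ≃ₗᵢ⋆[ℂ] H)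
    (δ : Fin n → H →ₗ.[ℂ] H) (Γ : H →L[ℂ] H) (s : ℤˣ) : Prop :=
  ∃ (Dv : H →ₗ.[ℂ] H) (Z : H →L[ℂ] H),
    D = Dv + horizontal n s D Γ + ofBounded Z ∧
    (∀ ψ (h : ψ ∈ Dv.domain), ψ ∈ commonKernel δ → Dv ⟨ψ, h⟩ = 0) ∧
    CommutesUpTo Dv Γ (if Even n then -1 else 1) ∧
    (∀ j, StronglyCommutes (δ j) Dv) ∧
    (∀ a, Commute Z (π a)) ∧
    ∃ Z' : H →L[ℂ] H, IsSelfAdjoint Z' ∧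
      ∀ a ψ, rightAction π J a (Z ψ) = Z' (rightAction π J a ψ)

end Triples

end TorusTriple

/-! On `H₀`, which reduces `D`, the operator `D_v` vanishes, so there `D_h` is `D - Z`. The
restriction of `D` is selfadjoint with compact resolvent because `H₀` is invariant under the
resolvents of `D`. As `D` and `D_h` are both symmetric, `Z` is symmetric on a dense subspace of `H₀`
and hence selfadjoint there. Thus `D₀` is a bounded selfadjoint perturbation of the restriction of
`D`, by an operator that commutes with `B`: selfadjointness, compactness of the resolvent, and the
commutators with `B` (hence the first order condition) all pass from `D` to `D₀`. -/

namespace TorusTriple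

open scoped InnerProductSpace ComplexConjugate

section Graph

theorem mk_mem_graph_iff {R E F : Type*} [Ring R] [AddCommGroup E] [Module R E] [AddCommGroup F]
    [Module R F] {T : E →ₗ.[R] F} {x : E} {y : F} :
    (x, y) ∈ T.graph ↔ ∃ h : x ∈ T.domain, T ⟨x, h⟩ = y := by
  simp [LinearPMap.mem_graph_iff]

variable {H : Type*} [NormedAddCommGroup H] [InnerProductSpace ℂ H] {T : H →ₗ.[ℂ] H}

theorem isFormalAdjoint_iff_graph {T' : H →ₗ.[ℂ] H} :
    T.IsFormalAdjoint T' ↔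
      ∀ x y u v, (x, y) ∈ T.graph → (u, v) ∈ T'.graph → ⟪y, u⟫_ℂ = ⟪x, v⟫_ℂ := by
  simp only [LinearPMap.IsFormalAdjoint, mk_mem_graph_iff, Subtype.forall]
  exact ⟨fun h x y u v ⟨hx, hy⟩ ⟨hu, hv⟩ => hy ▸ hv ▸ h x hx u hu,
    fun h x hx u hu => h x _ u _ ⟨hx, rfl⟩ ⟨hu, rfl⟩⟩

theorem commutesUpTo_iff_graph {S : H → H} {c : ℤ} :
    CommutesUpTo T S c ↔ ∀ x y, (x, y) ∈ T.graph → (S x, c • S y) ∈ T.graph := by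
  simp only [CommutesUpTo, mk_mem_graph_iff]
  exact ⟨fun h x y ⟨hx, hy⟩ => hy ▸ h x hx, fun h x hx => h x _ ⟨hx, rfl⟩⟩

theorem stronglyCommutes_iff_graph {δ : H →ₗ.[ℂ] H} :
    StronglyCommutes δ T ↔ ∀ z : ℂ, z.im ≠ 0 → ∀ x u v, (x, u) ∈ δ.graph →
      (u - z • x, v) ∈ T.graph → ∃ w, (x, w) ∈ T.graph ∧ (w, v + z • w) ∈ δ.graph := by
  simp only [StronglyCommutes, mk_mem_graph_iff]
  refine forall₂_congr fun z _ => ⟨?_, fun h x hx hu => ?_⟩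
  · rintro h x _ _ ⟨hx, rfl⟩ ⟨hu, rfl⟩
    obtain ⟨hxT, hw, h⟩ := h x hx hu
    exact ⟨_, ⟨hxT, rfl⟩, hw, sub_eq_iff_eq_add.mp h⟩
  · obtain ⟨_, ⟨hxT, rfl⟩, hw, h⟩ := h x _ _ ⟨hx, rfl⟩ ⟨hu, rfl⟩
    exact ⟨hxT, hw, sub_eq_iff_eq_add.mpr h⟩

theorem isCommutator_iff_graph {S C : H →L[ℂ] H} :
    IsCommutator T S C ↔ ∀ x y, (x, y) ∈ T.graph → (S x, S y + C x) ∈ T.graph := by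
  simp only [IsCommutator, mk_mem_graph_iff, sub_eq_iff_eq_add']
  exact ⟨fun h x y ⟨hx, hy⟩ => hy ▸ h x hx, fun h x hx => h x _ ⟨hx, rfl⟩⟩

theorem hasCompactResolvent_iff_graph :
    HasCompactResolvent T ↔ ∃ R : H →L[ℂ] H, IsCompactOperator R ∧
      (∀ ψ, (R ψ, ψ + Complex.I • R ψ) ∈ T.graph) ∧
      ∀ x y, (x, y) ∈ T.graph → R (y - Complex.I • x) = x := by
  simp only [HasCompactResolvent, mk_mem_graph_iff, sub_eq_iff_eq_add]
  exact exists_congr fun R => and_congr_right' <| and_congr_right'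
    ⟨fun h x y ⟨hx, hy⟩ => hy ▸ h x hx, fun h x hx => h x _ ⟨hx, rfl⟩⟩

theorem mk_mem_graph_sub_ofBounded_iff {Z : H →L[ℂ] H} {x y : H} :
    (x, y) ∈ (T - ofBounded Z).graph ↔ (x, y + Z x) ∈ T.graph := by
  simp only [mk_mem_graph_iff, ← sub_eq_iff_eq_add]
  exact ⟨fun ⟨hx, h⟩ => ⟨hx.1, h⟩, fun ⟨hx, h⟩ => ⟨⟨hx, trivial⟩, h⟩⟩

theorem mem_commonKernel_iff_graph {n : ℕ} {δ : Fin n → H →ₗ.[ℂ] H} {ψ : H} :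
    ψ ∈ commonKernel δ ↔ ∀ j, (ψ, 0) ∈ (δ j).graph := by
  simp only [mem_commonKernel, mk_mem_graph_iff]

end Graph

section SelfAdjoint

variable {H : Type*} [NormedAddCommGroup H] [InnerProductSpace ℂ H] {T : H →ₗ.[ℂ] H}

theorem abs_im_mul_norm_le_norm_sub_smul (hT : T.IsFormalAdjoint T) {x y : H}
    (h : (x, y) ∈ T.graph) (z : ℂ) : |z.im| * ‖x‖ ≤ ‖y - z • x‖ := by
  have h_real : (⟪x, y⟫_ℂ).im = 0 := by
    rw [← Complex.conj_eq_iff_im, inner_conj_symm]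
    exact isFormalAdjoint_iff_graph.mp hT _ _ _ _ h h
  have h_im : (⟪x, y - z • x⟫_ℂ).im = -(z.im * ‖x‖ ^ 2) := by
    rw [inner_sub_right, inner_smul_right, inner_self_eq_norm_sq_to_K, Complex.sub_im, h_real]
    simp [← Complex.ofReal_pow]
  have h_le : |z.im| * ‖x‖ * ‖x‖ ≤ ‖y - z • x‖ * ‖x‖ :=
    calc |z.im| * ‖x‖ * ‖x‖ = |(⟪x, y - z • x⟫_ℂ).im| := by
          rw [h_im, abs_neg, abs_mul, abs_of_nonneg (sq_nonneg ‖x‖)]; ring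
      _ ≤ ‖y - z • x‖ * ‖x‖ := by
          rw [mul_comm]
          exact (Complex.abs_im_le_norm _).trans (norm_inner_le_norm _ _)
  rcases (norm_nonneg x).eq_or_lt with hx | hx
  · simp [← hx]
  · exact le_of_mul_le_mul_right h_le hx

theorem eq_zero_of_mem_graph_smul_self (hT : T.IsFormalAdjoint T) {z : ℂ} (hz : z.im ≠ 0) {x : H}
    (h : (x, z • x) ∈ T.graph) : x = 0 := by
  have h_le := abs_im_mul_norm_le_norm_sub_smul hT h z
  rw [sub_self, norm_zero] at h_le
  exact norm_le_zero_iff.mp (nonpos_of_mul_nonpos_right h_le (abs_pos.mpr hz))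

theorem isClosed_map_graph_snd_sub_smul_fst [CompleteSpace H] (hT : T.IsFormalAdjoint T)
    (hcl : T.IsClosed) {z : ℂ} (hz : z.im ≠ 0) :
    IsClosed (T.graph.map (LinearMap.snd ℂ H H - z • LinearMap.fst ℂ H H) : Set H) := by
  have : CompleteSpace T.graph := hcl.completeSpace_coe
  let f : T.graph →L[ℂ] H :=
    (ContinuousLinearMap.snd ℂ H H - z • ContinuousLinearMap.fst ℂ H H).comp T.graph.subtypeL
  have h_antilipschitz : AntilipschitzWith (1 + (1 + ‖z‖₊) / ‖z.im‖₊) f := by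
    refine AddMonoidHomClass.antilipschitz_of_bound f ?_
    rintro ⟨⟨x, y⟩, h⟩
    have h_fst : ‖x‖ ≤ ‖y - z • x‖ / |z.im| := by
      rw [le_div_iff₀' (abs_pos.mpr hz)]
      exact abs_im_mul_norm_le_norm_sub_smul hT h z
    calc max ‖x‖ ‖y‖ ≤ ‖x‖ + ‖y‖ := max_le_add_of_nonneg (norm_nonneg x) (norm_nonneg y)
      _ ≤ ‖x‖ + (‖y - z • x‖ + ‖z‖ * ‖x‖) := by
        rw [← norm_smul]
        gcongr
        exact norm_le_norm_sub_add y (z • x)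
      _ = ‖y - z • x‖ + (1 + ‖z‖) * ‖x‖ := by ring
      _ ≤ ‖y - z • x‖ + (1 + ‖z‖) * (‖y - z • x‖ / |z.im|) := by gcongr
      _ = (1 + (1 + ‖z‖) / |z.im|) * ‖y - z • x‖ := by ring
  have h_range : Set.range f =
      T.graph.map (LinearMap.snd ℂ H H - z • LinearMap.fst ℂ H H) := by
    ext ψ
    simp [f]
  exact h_range ▸ h_antilipschitz.isClosed_range f.uniformContinuous

variable [CompleteSpace H]

theorem isSelfAdjoint_iff_graph :
    IsSelfAdjoint T ↔ Dense (T.domain : Set H) ∧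
      ∀ x y, (x, y) ∈ T.graph ↔ ∀ a b, (a, b) ∈ T.graph → ⟪b, x⟫_ℂ = ⟪a, y⟫_ℂ := by
  have h_iff (hd : Dense (T.domain : Set H)) : IsSelfAdjoint T ↔
      ∀ x y, (x, y) ∈ T.graph ↔ ∀ a b, (a, b) ∈ T.graph → ⟪b, x⟫_ℂ = ⟪a, y⟫_ℂ := by
    simp only [← sub_eq_zero (a := ⟪_, _⟫_ℂ), ← Submodule.mem_adjoint_iff T.graph (_, _),
      LinearPMap.isSelfAdjoint_def, ← LinearPMap.adjoint_graph_eq_graph_adjoint hd]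
    exact ⟨fun h x y => by rw [h],
      fun h => LinearPMap.eq_of_eq_graph (SetLike.ext fun p => (h p.1 p.2).symm)⟩
  exact ⟨fun hT => ⟨hT.dense_domain, (h_iff hT.dense_domain).mp hT⟩, fun h => (h_iff h.1).mpr h.2⟩

theorem isFormalAdjoint_of_isSelfAdjoint (hT : IsSelfAdjoint T) : T.IsFormalAdjoint T :=
  isFormalAdjoint_iff_graph.mpr fun x y u v h h' =>
    ((isSelfAdjoint_iff_graph.mp hT).2 u v).mp h' x y h

theorem exists_mem_graph_add_smul (hT : IsSelfAdjoint T) {z : ℂ} (hz : z.im ≠ 0) (ψ : H) :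
    ∃ x, (x, ψ + z • x) ∈ T.graph := by
  have hsymm := isFormalAdjoint_of_isSelfAdjoint hT
  let f : H × H →ₗ[ℂ] H := LinearMap.snd ℂ H H - z • LinearMap.fst ℂ H H
  have : CompleteSpace (T.graph.map f) :=
    (isClosed_map_graph_snd_sub_smul_fst hsymm hT.isClosed hz).completeSpace_coe
  have h_orthogonal : (T.graph.map f)ᗮ = ⊥ := by
    refine (Submodule.eq_bot_iff _).mpr fun φ hφ => ?_
    have h_mem : (φ, conj z • φ) ∈ T.graph := by
      refine ((isSelfAdjoint_iff_graph.mp hT).2 _ _).mpr fun a b hab => ?_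
      have h := (Submodule.mem_orthogonal _ φ).mp hφ _ (Submodule.mem_map_of_mem hab)
      simpa [f, inner_sub_left, inner_smul_left, inner_smul_right, sub_eq_zero] using h
    exact eq_zero_of_mem_graph_smul_self hsymm (by simpa using hz) h_mem
  have h_top : ψ ∈ T.graph.map f := by
    rw [(Submodule.orthogonal_eq_bot_iff).mp h_orthogonal]
    trivial
  obtain ⟨⟨x, y⟩, hxy, rfl⟩ := h_top
  exact ⟨x, by simpa [f] using hxy⟩

theorem exists_resolvent (hT : IsSelfAdjoint T) {z : ℂ} (hz : z.im ≠ 0) :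
    ∃ R : H →L[ℂ] H, (∀ ψ, (R ψ, ψ + z • R ψ) ∈ T.graph) ∧
      ∀ x y, (x, y) ∈ T.graph → R (y - z • x) = x := by
  have hsymm := isFormalAdjoint_of_isSelfAdjoint hT
  choose R hR using exists_mem_graph_add_smul hT hz
  have h_unique (x ψ : H) (h : (x, ψ + z • x) ∈ T.graph) : R ψ = x := by
    refine sub_eq_zero.mp (eq_zero_of_mem_graph_smul_self hsymm hz ?_)
    convert T.graph.sub_mem (hR ψ) h using 1
    simp [smul_sub]
  have h_add (ψ φ : H) : R (ψ + φ) = R ψ + R φ := h_unique _ _ (by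
    convert T.graph.add_mem (hR ψ) (hR φ) using 1
    simp only [Prod.mk_add_mk, smul_add, add_add_add_comm])
  have h_smul (c : ℂ) (ψ : H) : R (c • ψ) = c • R ψ := h_unique _ _ (by
    convert T.graph.smul_mem c (hR ψ) using 1
    simp only [Prod.smul_mk, smul_add, smul_comm z c])
  have h_bound (ψ : H) : ‖R ψ‖ ≤ |z.im|⁻¹ * ‖ψ‖ := by
    rw [le_inv_mul_iff₀ (abs_pos.mpr hz)]
    simpa using abs_im_mul_norm_le_norm_sub_smul hsymm (hR ψ) z
  exact ⟨LinearMap.mkContinuous ⟨⟨R, h_add⟩, h_smul⟩ |z.im|⁻¹ h_bound, hR,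
    fun x y h => h_unique x (y - z • x) (by simpa using h)⟩

theorem isSelfAdjoint_of_forall_exists_mem_graph (hT : T.IsFormalAdjoint T) {z : ℂ}
    (hz : ∀ ψ : H, ∃ x, (x, ψ + z • x) ∈ T.graph)
    (hz' : ∀ ψ : H, ∃ x, (x, ψ + conj z • x) ∈ T.graph) : IsSelfAdjoint T := by
  have hsymm := isFormalAdjoint_iff_graph.mp hT
  have h_mem (x y : H) (h : ∀ a b, (a, b) ∈ T.graph → ⟪b, x⟫_ℂ = ⟪a, y⟫_ℂ) :
      (x, y) ∈ T.graph := by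
    obtain ⟨u, hu⟩ := hz (y - z • x)
    obtain ⟨v, hv⟩ := hz' (x - u)
    have h_eq : x - u = 0 := by
      have hx := h _ _ hv
      have hu' := hsymm _ _ _ _ hv hu
      simp only [inner_add_left, inner_add_right, inner_sub_left, inner_sub_right, inner_smul_left,
        inner_smul_right, Complex.conj_conj] at hx hu'
      rw [← inner_self_eq_zero (𝕜 := ℂ)]
      simp only [inner_sub_left, inner_sub_right]
      linear_combination hx - hu'
    obtain rfl := sub_eq_zero.mp h_eq
    simpa using hu
  refine isSelfAdjoint_iff_graph.mpr
    ⟨?_, fun x y => ⟨fun h a b h' => hsymm _ _ _ _ h' h, h_mem x y⟩⟩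
  rw [Submodule.dense_iff_topologicalClosure_eq_top, Submodule.topologicalClosure_eq_top_iff,
    Submodule.eq_bot_iff]
  intro y hy
  have h_zero : ((0 : H), y) ∈ T.graph := h_mem 0 y fun a b hab => by
    rw [inner_zero_right, hy a (LinearPMap.mem_domain_of_mem_graph hab)]
  exact LinearPMap.graph_fst_eq_zero_snd T h_zero rfl

theorem isSelfAdjoint_sub_ofBounded (hT : IsSelfAdjoint T) {Z : H →L[ℂ] H}
    (hZ : IsSelfAdjoint Z) : IsSelfAdjoint (T - ofBounded Z) := by
  have hZ_symm := ContinuousLinearMap.isSelfAdjoint_iff_isSymmetric.mp hZ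
  obtain ⟨hd, hgraph⟩ := isSelfAdjoint_iff_graph.mp hT
  refine isSelfAdjoint_iff_graph.mpr ⟨?_, fun x y => ?_⟩
  · simpa [ofBounded, LinearPMap.sub_domain] using hd
  simp only [mk_mem_graph_sub_ofBounded_iff, hgraph x, inner_add_right]
  constructor
  · intro h a b hab
    have h := h a _ hab
    rw [inner_add_left, hZ_symm.apply_clm a x] at h
    exact add_right_cancel h
  · intro h a b hab
    rw [← hZ_symm.apply_clm, ← h a (b - Z a) (by simpa using hab), ← inner_add_left, sub_add_cancel]

theorem isSelfAdjoint_of_isFormalAdjoint_sub_ofBounded (hd : Dense (T.domain : Set H))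
    (hT : T.IsFormalAdjoint T) {Z : H →L[ℂ] H}
    (hZ : (T - ofBounded Z).IsFormalAdjoint (T - ofBounded Z)) : IsSelfAdjoint Z := by
  rw [ContinuousLinearMap.isSelfAdjoint_iff_isSymmetric]
  have h_domain (x y : T.domain) : ⟪Z x, (y : H)⟫_ℂ = ⟪(x : H), Z y⟫_ℂ := by
    have h := hZ ⟨x, x.2, trivial⟩ ⟨y, y.2, trivial⟩
    change ⟪T x - Z x, _⟫_ℂ = ⟪_, T y - Z y⟫_ℂ at h
    rw [inner_sub_left, inner_sub_right, hT x y] at h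
    exact sub_right_injective h
  exact hd.denseRange_val.induction_on₂ (isClosed_eq (by fun_prop) (by fun_prop)) h_domain

end SelfAdjoint

section Restriction

variable {H : Type*} [NormedAddCommGroup H] [InnerProductSpace ℂ H] {K : Submodule ℂ H}
  {T : H →ₗ.[ℂ] H}

/-- The restriction of an unbounded operator to an invariant subspace `K`, with domain
`K ∩ dom T`. -/
def restrictUnbounded (T : H →ₗ.[ℂ] H) (K : Submodule ℂ H)
    (h : ∀ x y, (x, y) ∈ T.graph → x ∈ K → y ∈ K) : K →ₗ.[ℂ] K where
  domain := T.domain.comap K.subtype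
  toFun := (T.toFun ∘ₗ K.subtype.restrict (q := T.domain) fun _ hx => hx).codRestrict K
    fun x => h _ _ (T.mem_graph ⟨x, x.2⟩) x.1.2

/-- The subspace `K` reduces the unbounded operator `T`: it is invariant under `T` and under the
resolvents `(T - z)⁻¹`, `z ∉ ℝ`. The second condition makes sense, and is used, before the
resolvents are known to exist. -/
structure Reduces (K : Submodule ℂ H) (T : H →ₗ.[ℂ] H) : Prop where
  apply_mem : ∀ x y, (x, y) ∈ T.graph → x ∈ K → y ∈ K
  mem_of_sub_smul_mem : ∀ z : ℂ, z.im ≠ 0 → ∀ x y, (x, y) ∈ T.graph → y - z • x ∈ K → x ∈ K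

variable {hT : ∀ x y, (x, y) ∈ T.graph → x ∈ K → y ∈ K}

theorem mk_mem_graph_restrictUnbounded_iff {x y : K} :
    (x, y) ∈ (restrictUnbounded T K hT).graph ↔ ((x : H), (y : H)) ∈ T.graph := by
  simp only [mk_mem_graph_iff]
  exact exists_congr fun _ => Subtype.ext_iff

theorem isRestriction_restrictUnbounded : IsRestriction T (restrictUnbounded T K hT) :=
  ⟨fun _ => Iff.rfl, fun _ _ _ => rfl⟩

theorem isFormalAdjoint_restrictUnbounded (h : T.IsFormalAdjoint T) :
    (restrictUnbounded T K hT).IsFormalAdjoint (restrictUnbounded T K hT) :=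
  fun x y => h ⟨x, x.2⟩ ⟨y, y.2⟩

theorem commutesUpTo_restrictUnbounded {S : H → H} {S₀ : K → K} {c : ℤ}
    (h : CommutesUpTo T S c) (hS : ∀ ψ, (S₀ ψ : H) = S ψ) :
    CommutesUpTo (restrictUnbounded T K hT) S₀ c := by
  simp only [commutesUpTo_iff_graph, mk_mem_graph_restrictUnbounded_iff, hS,
    Submodule.coe_smul_of_tower] at h ⊢
  exact fun x y => h x y

theorem apply_mem_of_dense (hK : IsClosed (K : Set H)) {s : Set K} (hs : Dense s) {S : H →L[ℂ] H}
    (h : ∀ ψ ∈ s, S ψ ∈ K) : ∀ ψ ∈ K, S ψ ∈ K := fun ψ hψ =>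
  hs.induction (P := fun ψ : K => S ψ ∈ K) h (hK.preimage (by fun_prop)) ⟨ψ, hψ⟩

theorem IsCommutator.apply_mem {S C : H →L[ℂ] H} (hC : IsCommutator T S C)
    (hK : IsClosed (K : Set H)) (hd : Dense ((restrictUnbounded T K hT).domain : Set K))
    (hS : ∀ ψ ∈ K, S ψ ∈ K) : ∀ ψ ∈ K, C ψ ∈ K := by
  refine apply_mem_of_dense hK hd fun ψ hψ => ?_
  have h := hT _ _ (isCommutator_iff_graph.mp hC _ _ (T.mem_graph ⟨ψ, hψ⟩)) (hS ψ ψ.2)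
  exact (K.add_mem_iff_right (hS _ (hT _ _ (T.mem_graph ⟨ψ, hψ⟩) ψ.2))).mp h

theorem IsCommutator.restrict {S C : H →L[ℂ] H} (h : IsCommutator T S C)
    (hS : ∀ ψ ∈ K, S ψ ∈ K) (hC : ∀ ψ ∈ K, C ψ ∈ K) :
    IsCommutator (restrictUnbounded T K hT) (S.restrict hS) (C.restrict hC) := by
  simp only [isCommutator_iff_graph, mk_mem_graph_restrictUnbounded_iff] at h ⊢
  exact fun x y => h x y

theorem IsCommutator.eq (hd : Dense (T.domain : Set H)) {S C C' : H →L[ℂ] H}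
    (h : IsCommutator T S C) (h' : IsCommutator T S C') : C = C' :=
  DFunLike.coe_injective <| C.continuous.ext_on hd C'.continuous fun ψ hψ => by
    obtain ⟨_, hC⟩ := h ψ hψ
    obtain ⟨_, hC'⟩ := h' ψ hψ
    exact hC.symm.trans hC'

theorem Reduces.isSelfAdjoint_restrictUnbounded [CompleteSpace H] [CompleteSpace K]
    (hK : Reduces K T) (h : IsSelfAdjoint T) :
    IsSelfAdjoint (restrictUnbounded T K hK.apply_mem) := by
  have h_exists (z : ℂ) (hz : z.im ≠ 0) (ψ : K) :
      ∃ x, (x, ψ + z • x) ∈ (restrictUnbounded T K hK.apply_mem).graph := by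
    obtain ⟨x, hx⟩ := exists_mem_graph_add_smul h hz (ψ : H)
    have hxK : x ∈ K := hK.mem_of_sub_smul_mem z hz _ _ hx (by simp)
    exact ⟨⟨x, hxK⟩, mk_mem_graph_restrictUnbounded_iff.mpr hx⟩
  exact isSelfAdjoint_of_forall_exists_mem_graph
    (isFormalAdjoint_restrictUnbounded (isFormalAdjoint_of_isSelfAdjoint h))
    (h_exists Complex.I (by simp)) (h_exists (conj Complex.I) (by simp))

theorem Reduces.hasCompactResolvent_restrictUnbounded [CompleteSpace K] (hK : Reduces K T)
    (h : HasCompactResolvent T) : HasCompactResolvent (restrictUnbounded T K hK.apply_mem) := by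
  obtain ⟨R, hR, hR_right, hR_left⟩ := hasCompactResolvent_iff_graph.mp h
  have hRK : ∀ ψ ∈ K, R ψ ∈ K := fun ψ hψ =>
    hK.mem_of_sub_smul_mem Complex.I (by simp) _ _ (hR_right ψ) (by simpa using hψ)
  refine hasCompactResolvent_iff_graph.mpr ⟨R.restrict hRK, hR.restrict' hRK, fun ψ => ?_,
    fun x y hxy => Subtype.ext (hR_left x y ?_)⟩
  · exact mk_mem_graph_restrictUnbounded_iff.mpr (hR_right ψ)
  · exact mk_mem_graph_restrictUnbounded_iff.mp hxy

end Restriction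

section RestrictedTriple

variable {A : Type*} [Ring A] [StarRing A] [Algebra ℂ A]
  {H : Type*} [NormedAddCommGroup H] [InnerProductSpace ℂ H] [CompleteSpace H]

/-- The restriction of an antiunitary operator to a subspace `K` with `J K = K`. -/
def restrictAntiunitary (J : H ≃ₗᵢ⋆[ℂ] H) (K : Submodule ℂ H) (h : ∀ ψ, J ψ ∈ K ↔ ψ ∈ K) :
    K ≃ₗᵢ⋆[ℂ] K where
  toFun ψ := ⟨J ψ, (h ψ).mpr ψ.2⟩
  invFun ψ := ⟨J.symm ψ, (h _).mp (by simp)⟩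
  map_add' ψ φ := Subtype.ext (map_add J (ψ : H) φ)
  map_smul' c ψ := Subtype.ext (J.map_smulₛₗ c (ψ : H))
  left_inv ψ := Subtype.ext (J.symm_apply_apply ψ)
  right_inv ψ := Subtype.ext (J.apply_symm_apply ψ)
  norm_map' ψ := J.norm_map ψ

/-- The restriction of a representation to an invariant closed subspace. -/
noncomputable def restrictRepresentation (π : A →⋆ₐ[ℂ] (H →L[ℂ] H)) (K : Submodule ℂ H)
    [CompleteSpace K] (h : ∀ a, ∀ ψ ∈ K, π a ψ ∈ K) : A →⋆ₐ[ℂ] (K →L[ℂ] K) where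
  toFun a := (π a).restrict (h a)
  map_one' := by ext ψ; simp
  map_mul' a b := by ext ψ; simp
  map_zero' := by ext ψ; simp
  map_add' a b := by ext ψ; simp
  commutes' c := by ext ψ; simp [Algebra.algebraMap_eq_smul_one]
  map_star' a := by
    rw [ContinuousLinearMap.star_eq_adjoint, ContinuousLinearMap.eq_adjoint_iff]
    intro x y
    simp only [Submodule.coe_inner, ContinuousLinearMap.coe_restrict_apply, map_star,
      ContinuousLinearMap.star_eq_adjoint, ContinuousLinearMap.adjoint_inner_left]

variable {π : A →⋆ₐ[ℂ] (H →L[ℂ] H)} {D : H →ₗ.[ℂ] H} {J : H ≃ₗᵢ⋆[ℂ] H}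
  {K : Submodule ℂ H} [CompleteSpace K] {hπ : ∀ a, ∀ ψ ∈ K, π a ψ ∈ K}
  {hJ : ∀ ψ, J ψ ∈ K ↔ ψ ∈ K}

theorem CommutantCondition.restrict (h : CommutantCondition π J) :
    CommutantCondition (restrictRepresentation π K hπ) (restrictAntiunitary J K hJ) :=
  fun a b => ContinuousLinearMap.ext fun ψ => Subtype.ext (DFunLike.congr_fun (h a b).eq (ψ : H))

theorem IsSpectralTriple.exists_isCommutator_apply_mem (h : IsSpectralTriple π D)
    (hK : Reduces K D) (hπ : ∀ a, ∀ ψ ∈ K, π a ψ ∈ K) (a : A) :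
    ∃ C, IsCommutator D (π a) C ∧ ∀ ψ ∈ K, C ψ ∈ K := by
  obtain ⟨C, hC⟩ := h.bounded_commutators a
  exact ⟨C, hC, hC.apply_mem (completeSpace_coe_iff_isComplete.mp ‹_›).isClosed
    (hK.isSelfAdjoint_restrictUnbounded h.selfAdjoint).dense_domain (hπ a)⟩

theorem IsSpectralTriple.restrict (h : IsSpectralTriple π D) (hK : Reduces K D) :
    IsSpectralTriple (restrictRepresentation π K hπ) (restrictUnbounded D K hK.apply_mem) where
  selfAdjoint := hK.isSelfAdjoint_restrictUnbounded h.selfAdjoint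
  bounded_commutators a :=
    have ⟨C, hC, hCK⟩ := h.exists_isCommutator_apply_mem hK hπ a
    ⟨C.restrict hCK, hC.restrict (hπ a) hCK⟩
  compact_resolvent := hK.hasCompactResolvent_restrictUnbounded h.compact_resolvent

theorem FirstOrderCondition.restrict (h : FirstOrderCondition π D J) (hD : IsSpectralTriple π D)
    (hK : Reduces K D) :
    FirstOrderCondition (restrictRepresentation π K hπ) (restrictUnbounded D K hK.apply_mem)
      (restrictAntiunitary J K hJ) := by
  intro a b C₀ hC₀
  obtain ⟨C, hC, hCK⟩ := hD.exists_isCommutator_apply_mem hK hπ a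
  obtain rfl : C₀ = C.restrict hCK :=
    hC₀.eq (hK.isSelfAdjoint_restrictUnbounded hD.selfAdjoint).dense_domain
      (hC.restrict (hπ a) hCK)
  ext ψ
  exact DFunLike.congr_fun (h a b C hC).eq (ψ : H)

end RestrictedTriple

section BoundedPerturbation

variable {H : Type*} [NormedAddCommGroup H] [InnerProductSpace ℂ H] {T : H →ₗ.[ℂ] H}
  {Z : H →L[ℂ] H}

theorem isCommutator_sub_ofBounded_iff {S C : H →L[ℂ] H} (hZ : Commute Z S) :
    IsCommutator (T - ofBounded Z) S C ↔ IsCommutator T S C := by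
  have hZS (x : H) : Z (S x) = S (Z x) := DFunLike.congr_fun hZ.eq x
  simp only [isCommutator_iff_graph, mk_mem_graph_sub_ofBounded_iff, hZS]
  refine forall_congr' fun x => ⟨fun h y hxy => ?_, fun h y hxy => ?_⟩
  · convert h (y - Z x) (by simpa using hxy) using 2
    rw [map_sub]
    abel
  · convert h (y + Z x) hxy using 2
    rw [map_add]
    abel

variable [CompleteSpace H]

theorem HasCompactResolvent.sub_ofBounded (h : HasCompactResolvent T)
    (hT : IsSelfAdjoint (T - ofBounded Z)) : HasCompactResolvent (T - ofBounded Z) := by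
  obtain ⟨R, hR, -, hR_left⟩ := hasCompactResolvent_iff_graph.mp h
  obtain ⟨R', hR'⟩ := exists_resolvent hT (z := Complex.I) (by simp)
  have h_resolvent_identity : R' = R.comp (1 + Z.comp R') := by
    ext ψ
    rw [← hR_left _ _ (mk_mem_graph_sub_ofBounded_iff.mp (hR'.1 ψ)), add_right_comm,
      add_sub_cancel_right]
    rfl
  refine hasCompactResolvent_iff_graph.mpr ⟨R', ?_, hR'⟩
  rw [h_resolvent_identity]
  exact hR.comp_clm _

variable {A : Type*} [Ring A] [StarRing A] [Algebra ℂ A] {π : A →⋆ₐ[ℂ] (H →L[ℂ] H)}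

theorem IsSpectralTriple.sub_ofBounded (h : IsSpectralTriple π T) (hZ : IsSelfAdjoint Z)
    (hcomm : ∀ a, Commute Z (π a)) : IsSpectralTriple π (T - ofBounded Z) where
  selfAdjoint := isSelfAdjoint_sub_ofBounded h.selfAdjoint hZ
  bounded_commutators a :=
    (h.bounded_commutators a).imp fun _ => (isCommutator_sub_ofBounded_iff (hcomm a)).mpr
  compact_resolvent :=
    h.compact_resolvent.sub_ofBounded (isSelfAdjoint_sub_ofBounded h.selfAdjoint hZ)

theorem FirstOrderCondition.sub_ofBounded {J : H ≃ₗᵢ⋆[ℂ] H} (h : FirstOrderCondition π T J)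
    (hcomm : ∀ a, Commute Z (π a)) : FirstOrderCondition π (T - ofBounded Z) J :=
  fun a b C hC => h a b C ((isCommutator_sub_ofBounded_iff (hcomm a)).mp hC)

end BoundedPerturbation

section CommonKernel

variable {n : ℕ} {H : Type*} [NormedAddCommGroup H] [InnerProductSpace ℂ H]
  {δ : Fin n → H →ₗ.[ℂ] H}

theorem isClosed_commonKernel (h : ∀ j, (δ j).IsClosed) : IsClosed (commonKernel δ : Set H) := by
  have h_eq : (commonKernel δ : Set H) =
      ⋂ j, (fun ψ => (ψ, 0)) ⁻¹' ((δ j).graph : Set (H × H)) := by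
    ext ψ
    simp [mem_commonKernel_iff_graph]
  rw [h_eq]
  exact isClosed_iInter fun j => (h j).preimage (by fun_prop)

theorem apply_mem_commonKernel {S : H → H} {c : ℤ} (hS : S 0 = 0)
    (h : ∀ j, CommutesUpTo (δ j) S c) : ∀ ψ ∈ commonKernel δ, S ψ ∈ commonKernel δ := by
  intro ψ hψ
  rw [mem_commonKernel_iff_graph] at hψ ⊢
  intro j
  simpa [hS] using commutesUpTo_iff_graph.mp (h j) _ _ (hψ j)

theorem inner_antiunitary (J : H ≃ₗᵢ⋆[ℂ] H) (x y : H) : ⟪J x, J y⟫_ℂ = ⟪y, x⟫_ℂ := by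
  have h_add : ‖J x + J y‖ = ‖x + y‖ := by rw [← map_add, J.norm_map]
  have h_sub : ‖J x - J y‖ = ‖x - y‖ := by rw [← map_sub, J.norm_map]
  have h_sub_I : ‖J x - Complex.I • J y‖ = ‖x + Complex.I • y‖ := by
    rw [← J.norm_map (x + _), map_add, J.map_smulₛₗ]
    simp [sub_eq_add_neg]
  have h_add_I : ‖J x + Complex.I • J y‖ = ‖x - Complex.I • y‖ := by
    rw [← J.norm_map (x - _), map_sub, J.map_smulₛₗ]
    simp
  rw [← inner_conj_symm y x, inner_eq_sum_norm_sq_div_four, inner_eq_sum_norm_sq_div_four x y]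
  simp only [RCLike.I_to_complex, h_add, h_sub, h_sub_I, h_add_I, map_div₀, map_add, map_sub,
    map_mul, map_pow, RCLike.conj_ofReal, Complex.conj_I, Complex.conj_ofNat]
  ring

theorem commutesUpTo_one_of_hasCore {T : H →ₗ.[ℂ] H} (hT : T.IsClosed) {𝒟 : Submodule ℂ H}
    (hcore : T.HasCore 𝒟) {S : H →L[ℂ] H}
    (h : ∀ x ∈ 𝒟, ∀ y, (x, y) ∈ T.graph → (S x, S y) ∈ T.graph) : CommutesUpTo T S 1 := by
  have h_closable : (T.domRestrict 𝒟).IsClosable :=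
    hT.isClosable.leIsClosable LinearPMap.domRestrict_le
  have h_subset : ((T.domRestrict 𝒟).graph : Set (H × H)) ⊆
      (fun p => (S p.1, S p.2)) ⁻¹' (T.graph : Set (H × H)) := by
    rintro ⟨x, y⟩ hxy
    exact h x (LinearPMap.mem_domain_of_mem_graph hxy).1 y
      (LinearPMap.le_graph_of_le LinearPMap.domRestrict_le hxy)
  have h_closure : (T.graph : Set (H × H)) = closure (T.domRestrict 𝒟).graph := by
    rw [← Submodule.topologicalClosure_coe, h_closable.graph_closure_eq_closure_graph,
      hcore.closure_eq]
  rw [commutesUpTo_iff_graph]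
  intro x y hxy
  rw [one_smul]
  exact closure_minimal h_subset (hT.preimage (by fun_prop)) (h_closure.subset hxy)

variable [CompleteSpace H]

theorem antiunitary_apply_mem_commonKernel_iff (hδ : ∀ j, IsSelfAdjoint (δ j)) {J : H ≃ₗᵢ⋆[ℂ] H}
    {c : ℤ} (hc : c ≠ 0) (hJ : ∀ j, CommutesUpTo (δ j) J c) (ψ : H) :
    J ψ ∈ commonKernel δ ↔ ψ ∈ commonKernel δ := by
  refine ⟨fun h => ?_, apply_mem_commonKernel (map_zero J) hJ ψ⟩
  rw [mem_commonKernel_iff_graph] at h ⊢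
  refine fun j => ((isSelfAdjoint_iff_graph.mp (hδ j)).2 _ _).mpr fun a b hab => ?_
  have h_inner := ((isSelfAdjoint_iff_graph.mp (hδ j)).2 _ _).mp (h j) _ _
    (commutesUpTo_iff_graph.mp (hJ j) _ _ hab)
  rw [inner_zero_right, ← Int.cast_smul_eq_zsmul ℂ, inner_smul_left, mul_eq_zero,
    inner_eq_zero_symm, inner_antiunitary] at h_inner
  rw [inner_zero_right]
  exact h_inner.resolve_left (by simpa using hc)

theorem mem_graph_zero_of_stronglyCommutes {δ T : H →ₗ.[ℂ] H} (hδ : IsSelfAdjoint δ)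
    (hT : T.IsFormalAdjoint T) (h : StronglyCommutes δ T) {z : ℂ} (hz : z.im ≠ 0) {x y : H}
    (hxy : (x, y) ∈ T.graph) (hker : (y - z • x, 0) ∈ δ.graph) : (x, 0) ∈ δ.graph := by
  have hδ_symm := isFormalAdjoint_of_isSelfAdjoint hδ
  obtain ⟨χ, hχ⟩ := exists_mem_graph_add_smul hδ (z := Complex.I) (by simp) x
  obtain ⟨w, hχT, hw⟩ := stronglyCommutes_iff_graph.mp h Complex.I (by simp) χ _ y hχ
    (by simpa using hxy)
  -- `(δ - i)⁻¹` is multiplication by `i` on `ker δ`: it remains to see that `χ = i x`.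
  have h_range : w - z • χ = Complex.I • (y - z • x) := by
    refine sub_eq_zero.mp (eq_zero_of_mem_graph_smul_self hδ_symm (z := Complex.I) (by simp) ?_)
    convert δ.graph.sub_mem (δ.graph.sub_mem hw (δ.graph.smul_mem z hχ))
      (δ.graph.smul_mem Complex.I hker) using 1
    ext
    · rfl
    · dsimp only [Prod.snd_sub, Prod.smul_snd]
      linear_combination (norm := module) -Complex.I_mul_I • (y - z • x)
  have h_fst : χ = Complex.I • x := by
    refine sub_eq_zero.mp (eq_zero_of_mem_graph_smul_self hT hz ?_)
    convert T.graph.sub_mem hχT (T.graph.smul_mem Complex.I hxy) using 1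
    ext
    · rfl
    · dsimp only [Prod.snd_sub, Prod.smul_snd]
      linear_combination (norm := module) -h_range
  have h_smul : (Complex.I • x, (0 : H)) ∈ δ.graph := by
    simpa [h_fst, smul_smul] using hχ
  convert δ.graph.smul_mem (-Complex.I) h_smul using 1
  simp [smul_smul]

theorem reduces_commonKernel {T : H →ₗ.[ℂ] H} (hδ : ∀ j, IsSelfAdjoint (δ j))
    (hT : T.IsFormalAdjoint T) (h : ∀ j, StronglyCommutes (δ j) T) :
    Reduces (commonKernel δ) T where
  apply_mem x y hxy hx := by
    rw [mem_commonKernel_iff_graph] at hx ⊢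
    intro j
    obtain ⟨w, hw, hw'⟩ := stronglyCommutes_iff_graph.mp (h j) Complex.I (by simp) x 0
      (-(Complex.I • y)) (hx j) (by simpa using T.graph.neg_mem (T.graph.smul_mem Complex.I hxy))
    obtain rfl : w = y := LinearPMap.mem_graph_snd_inj _ hw hxy rfl
    simpa using hw'
  mem_of_sub_smul_mem z hz x y hxy hx := by
    rw [mem_commonKernel_iff_graph] at hx ⊢
    exact fun j => mem_graph_zero_of_stronglyCommutes (hδ j) hT (h j) hz hxy (hx j)

end CommonKernel


section Horizontal

/-- The factor `c` in `D_h = c (Γ D Γ + (-1)ⁿ D)`, a formula for the horizontal Dirac operator that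
is valid for both parities of `n`. -/
noncomputable def horizontalCoeff (n : ℕ) (s : ℤˣ) : ℝ :=
  if Even n then 1 / 2 else (s : ℤ) * (1 / 2)

variable {H : Type*} [NormedAddCommGroup H] [InnerProductSpace ℂ H] {n : ℕ} {s : ℤˣ}
  {D : H →ₗ.[ℂ] H} {Γ : H →L[ℂ] H}

theorem mem_domain_horizontal_iff {x : H} :
    x ∈ (horizontal n s D Γ).domain ↔ Γ x ∈ D.domain ∧ x ∈ D.domain := by
  unfold horizontal
  split_ifs <;> rfl

theorem horizontal_domain_le : (horizontal n s D Γ).domain ≤ D.domain :=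
  fun _ hx => (mem_domain_horizontal_iff.mp hx).2

theorem horizontal_apply (hΓ : Γ * Γ = 1) {x : H} (hx : x ∈ (horizontal n s D Γ).domain)
    (hΓx : Γ x ∈ D.domain) (hxD : x ∈ D.domain) :
    horizontal n s D Γ ⟨x, hx⟩ =
      (horizontalCoeff n s : ℂ) • (Γ (D ⟨Γ x, hΓx⟩) + (-1 : ℂ) ^ n • D ⟨x, hxD⟩) := by
  have hΓΓ (v : H) : Γ (Γ v) = v := DFunLike.congr_fun hΓ v
  revert hx
  rcases n.even_or_odd with hn | hn
  · rw [horizontal, horizontalCoeff, if_pos hn, if_pos hn, hn.neg_one_pow]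
    intro hx
    change (1 / 2 : ℂ) • Γ (D ⟨Γ x, hΓx⟩ + Γ (D ⟨x, hxD⟩)) = _
    simp [hΓΓ]
  · rw [horizontal, horizontalCoeff, if_neg (Nat.not_even_iff_odd.mpr hn),
      if_neg (Nat.not_even_iff_odd.mpr hn), hn.neg_one_pow]
    intro hx
    change (((s : ℤ) : ℂ) * (1 / 2)) • Γ (D ⟨Γ x, hΓx⟩ - Γ (D ⟨x, hxD⟩)) = _
    simp [hΓΓ, sub_eq_add_neg]

theorem mk_mem_graph_horizontal_iff (hΓ : Γ * Γ = 1) {x y : H} :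
    (x, y) ∈ (horizontal n s D Γ).graph ↔ ∃ u v, (Γ x, u) ∈ D.graph ∧ (x, v) ∈ D.graph ∧
      y = (horizontalCoeff n s : ℂ) • (Γ u + (-1 : ℂ) ^ n • v) := by
  simp only [mk_mem_graph_iff]
  constructor
  · rintro ⟨hx, rfl⟩
    obtain ⟨hΓx, hxD⟩ := mem_domain_horizontal_iff.mp hx
    exact ⟨_, _, ⟨hΓx, rfl⟩, ⟨hxD, rfl⟩, horizontal_apply hΓ hx hΓx hxD⟩
  · rintro ⟨_, _, ⟨hΓx, rfl⟩, ⟨hxD, rfl⟩, rfl⟩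
    exact ⟨mem_domain_horizontal_iff.mpr ⟨hΓx, hxD⟩, horizontal_apply hΓ _ hΓx hxD⟩

theorem horizontal_apply_mem (hΓ : Γ * Γ = 1) {K : Submodule ℂ H} (hΓK : ∀ ψ ∈ K, Γ ψ ∈ K)
    (hD : ∀ x y, (x, y) ∈ D.graph → x ∈ K → y ∈ K) :
    ∀ x y, (x, y) ∈ (horizontal n s D Γ).graph → x ∈ K → y ∈ K := by
  intro x y hxy hx
  obtain ⟨u, v, hu, hv, rfl⟩ := (mk_mem_graph_horizontal_iff hΓ).mp hxy
  exact K.smul_mem _ (K.add_mem (hΓK u (hD _ _ hu (hΓK x hx))) (K.smul_mem _ (hD _ _ hv hx)))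

theorem isFormalAdjoint_horizontal [CompleteSpace H] (hD : D.IsFormalAdjoint D) (hΓ : Γ * Γ = 1)
    (hΓ' : IsSelfAdjoint Γ) : (horizontal n s D Γ).IsFormalAdjoint (horizontal n s D Γ) := by
  have hΓ_symm := (ContinuousLinearMap.isSelfAdjoint_iff_isSymmetric.mp hΓ').apply_clm
  rw [isFormalAdjoint_iff_graph] at hD ⊢
  intro x y x' y' hxy hxy'
  obtain ⟨u, v, hu, hv, rfl⟩ := (mk_mem_graph_horizontal_iff hΓ).mp hxy
  obtain ⟨u', v', hu', hv', rfl⟩ := (mk_mem_graph_horizontal_iff hΓ).mp hxy'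
  have h_conj : ⟪Γ u, x'⟫_ℂ = ⟪x, Γ u'⟫_ℂ := by
    rw [hΓ_symm, hD _ _ _ _ hu hu', hΓ_symm]
  simp only [inner_smul_left, inner_smul_right, inner_add_left, inner_add_right, map_pow, map_neg,
    map_one, Complex.conj_ofReal, h_conj, hD _ _ _ _ hv hv']

theorem commutesUpTo_horizontal (hΓ : Γ * Γ = 1) {γ : H →L[ℂ] H} {c : ℤ}
    (hγΓ : Γ * γ = (-1 : ℂ) ^ n • (γ * Γ)) (hγ : CommutesUpTo D γ c) :
    CommutesUpTo (horizontal n s D Γ) γ c := by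
  have h_comm (x : H) : Γ (γ x) = (-1 : ℂ) ^ n • γ (Γ x) := DFunLike.congr_fun hγΓ x
  rw [commutesUpTo_iff_graph] at hγ ⊢
  intro x y hxy
  obtain ⟨u, v, hu, hv, rfl⟩ := (mk_mem_graph_horizontal_iff hΓ).mp hxy
  refine (mk_mem_graph_horizontal_iff hΓ).mpr
    ⟨(-1 : ℂ) ^ n • c • γ u, c • γ v, ?_, hγ _ _ hv, ?_⟩
  · simpa [h_comm] using D.graph.smul_mem ((-1 : ℂ) ^ n) (hγ _ _ hu)
  · have h_sq : (-1 : ℂ) ^ n * (-1 : ℂ) ^ n = 1 := by rw [← mul_pow]; simp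
    simp only [map_smul, map_zsmul, map_add, h_comm, smul_comm c, smul_add, smul_smul, h_sq,
      one_smul]

end Horizontal

section VerticalPart

variable {H : Type*} [NormedAddCommGroup H] [InnerProductSpace ℂ H] {K : Submodule ℂ H}
  {D Dv W : H →ₗ.[ℂ] H} {Z : H →L[ℂ] H}

theorem mem_graph_iff_of_eq_add (hsum : D = Dv + W + ofBounded Z)
    (hDv : ∀ ψ (h : ψ ∈ Dv.domain), ψ ∈ K → Dv ⟨ψ, h⟩ = 0) (hW : W.domain ≤ D.domain) {x y : H}
    (hx : x ∈ K) : (x, y) ∈ W.graph ↔ (x, y + Z x) ∈ D.graph := by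
  have h_apply (h : x ∈ (Dv + W + ofBounded Z).domain) :
      (Dv + W + ofBounded Z) ⟨x, h⟩ = W ⟨x, h.1.2⟩ + Z x := by
    change Dv ⟨x, h.1.1⟩ + W ⟨x, h.1.2⟩ + Z x = _
    rw [hDv x _ hx, zero_add]
  subst hsum
  simp only [mk_mem_graph_iff]
  refine ⟨?_, fun ⟨h, hy⟩ => ⟨h.1.2, add_right_cancel ((h_apply h).symm.trans hy)⟩⟩
  rintro ⟨h, rfl⟩
  exact ⟨hW h, h_apply (hW h)⟩

variable (hsum : D = Dv + W + ofBounded Z)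
  (hDv : ∀ ψ (h : ψ ∈ Dv.domain), ψ ∈ K → Dv ⟨ψ, h⟩ = 0) (hW : W.domain ≤ D.domain)
  (hDK : ∀ x y, (x, y) ∈ D.graph → x ∈ K → y ∈ K) (hWK : ∀ x y, (x, y) ∈ W.graph → x ∈ K → y ∈ K)

include hsum hDv hW hWK in
theorem apply_mem_of_eq_add_ofBounded (hK : IsClosed (K : Set H))
    (hd : Dense ((restrictUnbounded D K hDK).domain : Set K)) : ∀ ψ ∈ K, Z ψ ∈ K := by
  refine apply_mem_of_dense hK hd fun ψ hψ => ?_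
  have hD := D.mem_graph ⟨ψ, hψ⟩
  have h : ((ψ : H), D ⟨ψ, hψ⟩ - Z ψ) ∈ W.graph :=
    (mem_graph_iff_of_eq_add hsum hDv hW ψ.2).mpr (by simpa using hD)
  exact (K.sub_mem_iff_right (hDK _ _ hD ψ.2)).mp (hWK _ _ h ψ.2)

include hsum hDv hW in
theorem restrictUnbounded_eq_sub_ofBounded (hZ : ∀ ψ ∈ K, Z ψ ∈ K) :
    restrictUnbounded W K hWK = restrictUnbounded D K hDK - ofBounded (Z.restrict hZ) := by
  refine LinearPMap.eq_of_eq_graph (SetLike.ext fun p => ?_)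
  rw [← Prod.mk.eta (p := p), mk_mem_graph_sub_ofBounded_iff, mk_mem_graph_restrictUnbounded_iff,
    mk_mem_graph_restrictUnbounded_iff]
  exact mem_graph_iff_of_eq_add hsum hDv hW p.1.2

variable {A : Type*} [Ring A] [StarRing A] [Algebra ℂ A] [CompleteSpace H] [CompleteSpace K]
  {π : A →⋆ₐ[ℂ] (H →L[ℂ] H)} {J : H ≃ₗᵢ⋆[ℂ] H} {hπ : ∀ a, ∀ ψ ∈ K, π a ψ ∈ K}
  {hJ : ∀ ψ, J ψ ∈ K ↔ ψ ∈ K} (hK : Reduces K D)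

include hsum hDv hW hWK in
theorem IsSpectralTriple.exists_restrictUnbounded_eq_sub_ofBounded (h : IsSpectralTriple π D)
    (hZ : ∀ a, Commute Z (π a)) :
    ∃ Z₀ : K →L[ℂ] K, (∀ a, Commute Z₀ (restrictRepresentation π K hπ a)) ∧
      restrictUnbounded W K hWK = restrictUnbounded D K hK.apply_mem - ofBounded Z₀ := by
  have hZK : ∀ ψ ∈ K, Z ψ ∈ K :=
    apply_mem_of_eq_add_ofBounded hsum hDv hW hK.apply_mem hWK
      (completeSpace_coe_iff_isComplete.mp ‹_›).isClosed
      (hK.isSelfAdjoint_restrictUnbounded h.selfAdjoint).dense_domain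
  exact ⟨Z.restrict hZK, fun a => ContinuousLinearMap.ext fun ψ =>
      Subtype.ext (DFunLike.congr_fun (hZ a).eq (ψ : H)),
    restrictUnbounded_eq_sub_ofBounded hsum hDv hW hK.apply_mem hWK hZK⟩

include hsum hDv hW hK in
theorem IsSpectralTriple.restrict_of_eq_add (h : IsSpectralTriple π D)
    (hW_symm : W.IsFormalAdjoint W) (hZ : ∀ a, Commute Z (π a)) :
    IsSpectralTriple (restrictRepresentation π K hπ) (restrictUnbounded W K hWK) := by
  obtain ⟨Z₀, hZ₀, h_eq⟩ :=
    h.exists_restrictUnbounded_eq_sub_ofBounded (hπ := hπ) hsum hDv hW hWK hK hZ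
  have hD₀ : IsSpectralTriple (restrictRepresentation π K hπ)
      (restrictUnbounded D K hK.apply_mem) := h.restrict hK
  have hZ₀_selfAdjoint : IsSelfAdjoint Z₀ :=
    isSelfAdjoint_of_isFormalAdjoint_sub_ofBounded hD₀.selfAdjoint.dense_domain
      (isFormalAdjoint_of_isSelfAdjoint hD₀.selfAdjoint)
      (h_eq ▸ isFormalAdjoint_restrictUnbounded (hT := hWK) hW_symm)
  exact h_eq ▸ hD₀.sub_ofBounded hZ₀_selfAdjoint hZ₀

include hsum hDv hW hK in
theorem FirstOrderCondition.restrict_of_eq_add (h : FirstOrderCondition π D J)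
    (hD : IsSpectralTriple π D) (hZ : ∀ a, Commute Z (π a)) :
    FirstOrderCondition (restrictRepresentation π K hπ) (restrictUnbounded W K hWK)
      (restrictAntiunitary J K hJ) := by
  obtain ⟨Z₀, hZ₀, h_eq⟩ :=
    hD.exists_restrictUnbounded_eq_sub_ofBounded (hπ := hπ) hsum hDv hW hWK hK hZ
  exact h_eq ▸ (h.restrict hD hK).sub_ofBounded hZ₀

end VerticalPart

section RightAction

variable {A B : Type*} [Ring A] [StarRing A] [Algebra ℂ A] [Ring B] [StarRing B] [Algebra ℂ B]
  {H : Type*} [NormedAddCommGroup H] [InnerProductSpace ℂ H] [CompleteSpace H]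

/-- The right action `a ↦ J a* J⁻¹` as a representation of the opposite algebra. -/
noncomputable def rightRepresentation (π : A →⋆ₐ[ℂ] (H →L[ℂ] H)) (J : H ≃ₗᵢ⋆[ℂ] H)
    [StarModule ℂ A] : Aᵐᵒᵖ →⋆ₐ[ℂ] (H →L[ℂ] H) where
  toFun a := rightAction π J a.unop
  map_one' := by ext ψ; simp [rightAction_apply]
  map_mul' a b := by ext ψ; simp [rightAction_apply]
  map_zero' := by ext ψ; simp [rightAction_apply]
  map_add' a b := by ext ψ; simp [rightAction_apply]
  commutes' c := by
    ext ψ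
    simp [rightAction_apply, Algebra.algebraMap_eq_smul_one, J.map_smulₛₗ]
  map_star' a := by
    rw [ContinuousLinearMap.star_eq_adjoint, ContinuousLinearMap.eq_adjoint_iff]
    intro x y
    obtain ⟨x, rfl⟩ := J.surjective x
    obtain ⟨y, rfl⟩ := J.surjective y
    simp only [rightAction_apply, J.symm_apply_apply, inner_antiunitary, MulOpposite.unop_star,
      star_star, map_star, ContinuousLinearMap.star_eq_adjoint,
      ContinuousLinearMap.adjoint_inner_left]

variable {π : A →⋆ₐ[ℂ] (H →L[ℂ] H)} {D : H →ₗ.[ℂ] H} {J : H ≃ₗᵢ⋆[ℂ] H} (f : B →⋆ₐ[ℂ] A)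

theorem rightAction_comp (b : B) : rightAction (π.comp f) J b = rightAction π J (f b) := by
  simp only [rightAction, StarAlgHom.comp_apply, map_star]

theorem IsSpectralTriple.comp (h : IsSpectralTriple π D) : IsSpectralTriple (π.comp f) D where
  selfAdjoint := h.selfAdjoint
  bounded_commutators b := h.bounded_commutators (f b)
  compact_resolvent := h.compact_resolvent

theorem CommutantCondition.comp (h : CommutantCondition π J) :
    CommutantCondition (π.comp f) J := fun a b => by
  rw [rightAction_comp]
  exact h (f a) (f b)

theorem FirstOrderCondition.comp (h : FirstOrderCondition π D J) :
    FirstOrderCondition (π.comp f) D J := fun a b C hC => by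
  rw [rightAction_comp]
  exact h (f a) (f b) C hC

end RightAction

section Equivariant

variable {n : ℕ} {A : Type*} [Ring A] [StarRing A] [Algebra ℂ A] [StarModule ℂ A]
  {𝒜 : (Fin n → ℤ) → Submodule ℂ A} [GradedAlgebra 𝒜]
  {H : Type*} [NormedAddCommGroup H] [InnerProductSpace ℂ H] [CompleteSpace H]
  {π : A →⋆ₐ[ℂ] (H →L[ℂ] H)} {D : H →ₗ.[ℂ] H} {J : H ≃ₗᵢ⋆[ℂ] H} {γ : H →L[ℂ] H}
  {δ : Fin n → H →ₗ.[ℂ] H}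

theorem IsTorusEquivariant.commutesUpTo_one_of_mem_zero (h : IsTorusEquivariant 𝒜 π D J γ δ)
    {b : A} (hb : b ∈ 𝒜 0) (j : Fin n) : CommutesUpTo (δ j) (π b) 1 := by
  obtain ⟨𝒟, hcore, hstable, hleibniz⟩ := h.leibniz
  have h_derivation : gradingDerivation 𝒜 j b = 0 := by
    simp [gradingDerivation_apply 𝒜 j 0 b hb]
  refine commutesUpTo_one_of_hasCore (h.selfAdjoint j).isClosed (hcore j) fun x hx y hxy => ?_
  obtain ⟨hxδ, rfl⟩ := mk_mem_graph_iff.mp hxy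
  refine mk_mem_graph_iff.mpr ⟨(hcore j).le_domain (hstable b x hx), ?_⟩
  rw [hleibniz j b x hx hxδ, h_derivation, map_zero, zero_apply, zero_add]

end Equivariant
end TorusTriple

open TorusTriple in
theorem mainTheorem2_general {n : ℕ} {A : Type*} [Ring A] [StarRing A] [Algebra ℂ A]
    [StarModule ℂ A] {H : Type*} [NormedAddCommGroup H] [InnerProductSpace ℂ H] [CompleteSpace H]
    {π : A →⋆ₐ[ℂ] (H →L[ℂ] H)} {D Dv : H →ₗ.[ℂ] H} {J : H ≃ₗᵢ⋆[ℂ] H} {γ Γ Z : H →L[ℂ] H}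
    {δ : Fin n → H →ₗ.[ℂ] H} {s : ℤˣ} (hD : IsSpectralTriple π D) (hJ : CommutantCondition π J)
    (hDJ : FirstOrderCondition π D J) (hγ : CommutesUpTo D γ (-1))
    (hδ : ∀ j, IsSelfAdjoint (δ j)) (hδD : ∀ j, StronglyCommutes (δ j) D)
    (hδπ : ∀ j a, CommutesUpTo (δ j) (π a) 1) (hδJ : ∀ j, CommutesUpTo (δ j) J (-1))
    (hδγ : ∀ j, CommutesUpTo (δ j) γ 1) (hδΓ : ∀ j, CommutesUpTo (δ j) Γ 1) (hΓ : Γ * Γ = 1)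
    (hΓ_selfAdjoint : IsSelfAdjoint Γ) (hΓγ : Γ * γ = (-1 : ℂ) ^ n • (γ * Γ))
    (hsum : D = Dv + horizontal n s D Γ + ofBounded Z)
    (hDv : ∀ ψ (h : ψ ∈ Dv.domain), ψ ∈ commonKernel δ → Dv ⟨ψ, h⟩ = 0)
    (hZ : ∀ a, Commute Z (π a)) :
    ∃ (_ : CompleteSpace (commonKernel δ)) (π₀ : A →⋆ₐ[ℂ] (commonKernel δ →L[ℂ] commonKernel δ))
      (D₀ : commonKernel δ →ₗ.[ℂ] commonKernel δ) (J₀ : commonKernel δ ≃ₗᵢ⋆[ℂ] commonKernel δ)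
      (γ₀ Γ₀ γΓ₀ : commonKernel δ →L[ℂ] commonKernel δ),
      (∀ a ψ, (π₀ a ψ : H) = π a ψ) ∧ IsRestriction (horizontal n s D Γ) D₀ ∧
      (∀ ψ, (J₀ ψ : H) = J ψ) ∧ (∀ ψ, (γ₀ ψ : H) = γ ψ) ∧ (∀ ψ, (Γ₀ ψ : H) = Γ ψ) ∧
      (∀ ψ, (γΓ₀ ψ : H) = γ (Γ ψ)) ∧ IsSpectralTriple π₀ D₀ ∧
      (∃ ρ₀ : Aᵐᵒᵖ →⋆ₐ[ℂ] (commonKernel δ →L[ℂ] commonKernel δ),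
        ∀ a, ρ₀ (MulOpposite.op a) = rightAction π₀ J₀ a) ∧
      CommutantCondition π₀ J₀ ∧ FirstOrderCondition π₀ D₀ J₀ ∧ CommutesUpTo D₀ γ₀ (-1) := by
  have hcomplete : CompleteSpace (commonKernel δ) :=
    (isClosed_commonKernel fun j => (hδ j).isClosed).completeSpace_coe
  have hπK (a : A) : ∀ ψ ∈ commonKernel δ, π a ψ ∈ commonKernel δ :=
    apply_mem_commonKernel (map_zero (π a)) fun j => hδπ j a
  have hJK := antiunitary_apply_mem_commonKernel_iff hδ (by decide) hδJ
  have hγK := apply_mem_commonKernel (map_zero γ) hδγ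
  have hΓK := apply_mem_commonKernel (map_zero Γ) hδΓ
  have hD_symm := isFormalAdjoint_of_isSelfAdjoint hD.selfAdjoint
  have hK : Reduces (commonKernel δ) D := reduces_commonKernel hδ hD_symm hδD
  have hhK := horizontal_apply_mem (n := n) (s := s) hΓ hΓK hK.apply_mem
  refine ⟨hcomplete, restrictRepresentation π _ hπK, restrictUnbounded (horizontal n s D Γ) _ hhK,
    restrictAntiunitary J _ hJK, γ.restrict hγK, Γ.restrict hΓK,
    (γ * Γ).restrict fun ψ hψ => hγK _ (hΓK ψ hψ), fun _ _ => rfl,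
    isRestriction_restrictUnbounded, fun _ => rfl, fun _ => rfl, fun _ => rfl, fun _ => rfl,
    ?_, ⟨rightRepresentation _ _, fun _ => rfl⟩, hJ.restrict, ?_, ?_⟩
  · exact hD.restrict_of_eq_add hsum hDv horizontal_domain_le hhK hK
      (isFormalAdjoint_horizontal hD_symm hΓ hΓ_selfAdjoint) hZ
  · exact hDJ.restrict_of_eq_add hsum hDv horizontal_domain_le hhK hK hD hZ
  · exact commutesUpTo_restrictUnbounded (commutesUpTo_horizontal hΓ hΓγ hγ) fun _ => rfl

theorem mainTheorem2 {n : ℕ}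
    {A : Type*} [Ring A] [StarRing A] [Algebra ℂ A] [StarModule ℂ A]
    (𝒜 : (Fin n → ℤ) → Submodule ℂ A) [GradedAlgebra 𝒜] [TorusTriple.StarGraded 𝒜]
    {H : Type*} [NormedAddCommGroup H] [InnerProductSpace ℂ H] [CompleteSpace H]
    (d : ℕ) (π : A →⋆ₐ[ℂ] (H →L[ℂ] H)) (D : H →ₗ.[ℂ] H) (J : H ≃ₗᵢ⋆[ℂ] H) (γ : H →L[ℂ] H)
    (δ : Fin n → H →ₗ.[ℂ] H) (Γ : H →L[ℂ] H) (s : ℤˣ)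
    (hreal : TorusTriple.IsEvenRealSpectralTriple d π D J γ)
    (hequiv : TorusTriple.IsTorusEquivariant 𝒜 π D J γ δ)
    (hproj : TorusTriple.IsProjectable π J γ δ Γ)
    (hiso : TorusTriple.HasIsometricFibres π D J δ Γ s) :
    ∃ (_ : CompleteSpace (TorusTriple.commonKernel δ))
      (π₀ : TorusTriple.invariants 𝒜 →⋆ₐ[ℂ]
        (TorusTriple.commonKernel δ →L[ℂ] TorusTriple.commonKernel δ))
      (D₀ : TorusTriple.commonKernel δ →ₗ.[ℂ] TorusTriple.commonKernel δ)
      (J₀ : TorusTriple.commonKernel δ ≃ₗᵢ⋆[ℂ] TorusTriple.commonKernel δ)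
      (γ₀ Γ₀ γΓ₀ : TorusTriple.commonKernel δ →L[ℂ] TorusTriple.commonKernel δ),
      -- the restrictions to the common kernel
      (∀ b ψ, (π₀ b ψ : H) = π (b : A) (ψ : H)) ∧
      TorusTriple.IsRestriction (TorusTriple.horizontal n s D Γ) D₀ ∧
      (∀ ψ, (J₀ ψ : H) = J (ψ : H)) ∧
      (∀ ψ, (γ₀ ψ : H) = γ (ψ : H)) ∧
      (∀ ψ, (Γ₀ ψ : H) = Γ (ψ : H)) ∧
      (∀ ψ, (γΓ₀ ψ : H) = γ (Γ (ψ : H))) ∧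
      -- their properties
      TorusTriple.IsSpectralTriple π₀ D₀ ∧
      (∃ ρ₀ : (TorusTriple.invariants 𝒜)ᵐᵒᵖ →⋆ₐ[ℂ]
          (TorusTriple.commonKernel δ →L[ℂ] TorusTriple.commonKernel δ),
        ∀ b, ρ₀ (MulOpposite.op b) = TorusTriple.rightAction π₀ J₀ b) ∧
      TorusTriple.CommutantCondition π₀ J₀ ∧
      TorusTriple.FirstOrderCondition π₀ D₀ J₀ ∧
      TorusTriple.CommutesUpTo D₀ γ₀ (-1) := by
  obtain ⟨Dv, Z, hsum, hDv, -, -, hZ, -⟩ := hiso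
  exact mainTheorem2_general (hreal.toIsSpectralTriple.comp (TorusTriple.invariants 𝒜).subtype)
    (hreal.commutant.comp _) (hreal.first_order.comp _) hreal.grading_D hequiv.selfAdjoint
    hequiv.delta_D (fun j b => hequiv.commutesUpTo_one_of_mem_zero b.2 j) hequiv.delta_J
    hequiv.delta_grading hproj.delta hproj.sq hproj.selfAdjoint hproj.grading hsum hDv
    fun b => hZ b
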